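/- All spaces are Tychonoff. A (Tychonoff) space is pseudocompact if every continuous real-valued function on it is bounded, and $X$ is locally pseudocompact if every point of $X$ has an open neighborhood with pseudocompact closure. An extension of $X$ is a space containing $X$ as a dense subspace; two extensions are identified if some homeomorphism between them fixes $X$ pointwise. A compactification (pseudocompactification) of $X$ is a compact Hausdorff (pseudocompact) extension of $X$, and the remainder of an extension $Y$ of $X$ is $Y\setminus X$. Let $\beta X$ be the Stone–Čech compactification and $\upsilon X\subseteq\beta X$ the Hewitt realcompactification of $X$, i.e. the set of all $p\in\beta X$ at which, for every continuous $f:X\to\mathbb R$, the continuous extension $\beta X\to\mathbb R\cup\{\infty\}$ of $f$ is finite. Put $\zeta X=X\cup\mathrm{cl}_{\beta X}(\beta X\setminus\upsilon X)$. **Theorem.** Let $X$ be a locally pseudocompact space. (1) Let $K$ be a compactification of $X$, let $\phi:\beta X\to K$ be the continuous extension of $\mathrm{id}_X$, and let $E$ be a compact subset of $K\setminus X$ containing $\phi[\zeta X\setminus X]$. Then the subspace $X\cup E$ of $K$ is a pseudocompactification of $X$ with compact remainder. (2) Conversely, every pseudocompactification $Y$ of $X$ with compact remainder is of this form: there are a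 compactification $K$ of $X$, with $\phi:\beta X\to K$ the continuous extension of $\mathrm{id}_X$, and a compact set $E\subseteq K\setminus X$ containing $\phi[\zeta X\setminus X]$, such that $Y$ is homeomorphic to the subspace $X\cup E$ of $K$ by a homeomorphism fixing $X$ pointwise. -/

import Mathlib

open Set

universe u v w

/-- A space is pseudocompact if it is Tychonoff and every continuous real-valued function
on it is bounded. -/
def IsPseudocompactSpace (Y : Type v) [TopologicalSpace Y] : Prop :=
  T35Space Y ∧ ∀ f : C(Y, ℝ), ∃ M : ℝ, ∀ y, |f y| ≤ M

/-- A Tychonoff space is locally pseudocompact if every point has an open neighbourhood whose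
closure (as a subspace) is pseudocompact. -/
def IsLocallyPseudocompactSpace (X : Type u) [TopologicalSpace X] : Prop :=
  T35Space X ∧ ∀ x : X, ∃ U : Set X, IsOpen U ∧ x ∈ U ∧ IsPseudocompactSpace (closure U)

/-- `K` is a compactification of `X` via `j`: a compact Hausdorff space in which `j` embeds `X`
as a dense subspace. -/
structure IsCompactification {X : Type u} {K : Type v} [TopologicalSpace X] [TopologicalSpace K]
    (j : X → K) : Prop where
  isDenseEmbedding : IsDenseEmbedding j
  compactSpace : CompactSpace K
  t2Space : T2Space K

/-- `Y` is a pseudocompactification of `X` via `i`: a pseudocompact space in which `i` embeds `X`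
as a dense subspace. -/
structure IsPseudocompactification {X : Type u} {Y : Type v} [TopologicalSpace X]
    [TopologicalSpace Y] (i : X → Y) : Prop where
  isDenseEmbedding : IsDenseEmbedding i
  isPseudocompactSpace : IsPseudocompactSpace Y

/-- The remainder `Y \ X` of the extension `i : X → Y` is compact. -/
def HasCompactRemainder {X : Type u} {Y : Type v} [TopologicalSpace Y] (i : X → Y) : Prop :=
  IsCompact (range i)ᶜ

/-- The extension of `f : X → ℝ` to a continuous map from `βX` to the one-point compactification
of `ℝ`. -/
noncomputable def stoneCechExtendOnePoint {X : Type u} [TopologicalSpace X] (f : C(X, ℝ)) :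
    StoneCech X → OnePoint ℝ :=
  stoneCechExtend (OnePoint.continuous_coe.comp f.continuous)

/-- The Hewitt realcompactification `υX` as a subset of `βX`: the points at which the extension
`βX → ℝ ∪ {∞}` of every continuous `f : X → ℝ` is finite. -/
def hewittRealcompactification (X : Type u) [TopologicalSpace X] : Set (StoneCech X) :=
  {p | ∀ f : C(X, ℝ), stoneCechExtendOnePoint f p ≠ OnePoint.infty}

/-- `ζX = X ∪ cl_{βX} (βX \ υX)`, as a subset of `βX`. -/
def zetaExtension (X : Type u) [TopologicalSpace X] : Set (StoneCech X) :=
  range (stoneCechUnit : X → StoneCech X) ∪ closure (hewittRealcompactification X)ᶜ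

/-- The map from `X` into the subspace `X ∪ E` of `K`, where `X` is placed in `K` by `j`. -/
def toUnion {X : Type u} {K : Type v} (j : X → K) (E : Set K) (x : X) :
    (range j ∪ E : Set K) :=
  ⟨j x, Or.inl (mem_range_self x)⟩

/-- The data in the construction of `X ∪ E`: `K` is a compactification of `X` via `j`,
`φ : βX → K` is the continuous extension of the inclusion of `X`, and `E` is a compact subset of
`K \ X` that contains `φ[ζX \ X]`. -/
structure IsAdmissible {X : Type u} {K : Type v} [TopologicalSpace X] [TopologicalSpace K]
    (j : X → K) (φ : StoneCech X → K) (E : Set K) : Prop where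
  isCompactification : IsCompactification j
  continuous_extension : Continuous φ
  extension_apply : ∀ x, φ (stoneCechUnit x) = j x
  isCompact : IsCompact E
  subset_remainder : E ⊆ (range j)ᶜ
  image_zeta_subset : φ '' (zetaExtension X \ range stoneCechUnit) ⊆ E

open Topology

/-! A point `p` of `βX` lies outside `υX` exactly when some continuous `f` on `X` is infinite, hence
unbounded on every neighbourhood, at `p`. For (1), an unbounded function on `X ∪ E` would be
infinite at such a `p`; but `φ p ∈ E`, where the function is finite and so locally bounded. For (2),
take `K = βY` and `E = Y \ X`. If `φ p ∉ E`, a cutoff vanishing near `E` turns `f` into an unbounded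
continuous function on `Y`. So `φ` maps `βX \ υX` into `E`, and its closure too because `E` is
compact. -/

theorem stoneCechExtendOnePoint_unit {X : Type u} [TopologicalSpace X] (f : C(X, ℝ)) (x : X) :
    stoneCechExtendOnePoint f (stoneCechUnit x) = (f x : OnePoint ℝ) :=
  congrFun (stoneCechExtend_extends _) x

theorem continuous_stoneCechExtendOnePoint {X : Type u} [TopologicalSpace X] (f : C(X, ℝ)) :
    Continuous (stoneCechExtendOnePoint f) :=
  continuous_stoneCechExtend _

/-- Near a point of `βX` at which the extension of `f` is infinite, `f` is unbounded. -/
theorem exists_lt_abs_of_extend_eq_infty {X : Type u} [TopologicalSpace X] {f : C(X, ℝ)}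
    {p : StoneCech X} (hp : stoneCechExtendOnePoint f p = OnePoint.infty)
    {V : Set (StoneCech X)} (hV : IsOpen V) (hpV : p ∈ V) (M : ℝ) :
    ∃ x : X, stoneCechUnit x ∈ V ∧ M < |f x| := by
  have hU : IsOpen ((↑) '' Metric.closedBall (0 : ℝ) M : Set (OnePoint ℝ))ᶜ :=
    OnePoint.isOpen_compl_image_coe.2
      ⟨Metric.isClosed_closedBall, isCompact_closedBall 0 M⟩
  have hW := hV.inter (hU.preimage (continuous_stoneCechExtendOnePoint f))
  obtain ⟨x, hxV, hxU⟩ := denseRange_stoneCechUnit.exists_mem_open hW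
    ⟨p, hpV, by simp [hp]⟩
  refine ⟨x, hxV, ?_⟩
  by_contra! h
  exact hxU ⟨f x, by simpa using h, (stoneCechExtendOnePoint_unit f x).symm⟩

/-- An unbounded continuous function on `X` has infinite extension at some point of `βX`. -/
theorem exists_extend_eq_infty_of_unbounded {X : Type u} [TopologicalSpace X] {f : C(X, ℝ)}
    (hf : ¬ ∃ M : ℝ, ∀ x, |f x| ≤ M) :
    ∃ p, stoneCechExtendOnePoint f p = OnePoint.infty := by
  by_contra! h
  have hc : IsCompact (range (stoneCechExtendOnePoint f)) :=
    isCompact_range (continuous_stoneCechExtendOnePoint f)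
  -- The image misses `∞`, so it is a compact subset of `ℝ`.
  have hc' : IsCompact ((↑) ⁻¹' range (stoneCechExtendOnePoint f) : Set ℝ) := by
    refine (OnePoint.isOpenEmbedding_coe (X := ℝ)).isInducing.isCompact_preimage' hc ?_
    rintro _ ⟨p, rfl⟩
    obtain ⟨r, hr⟩ := OnePoint.ne_infty_iff_exists.1 (h p)
    exact ⟨r, hr⟩
  obtain ⟨M, hM⟩ := hc'.isBounded.exists_norm_le
  exact hf ⟨M, fun x => hM _ ⟨stoneCechUnit x, stoneCechExtendOnePoint_unit f x⟩⟩

theorem isDenseEmbedding_toUnion {X : Type u} {K : Type v} [TopologicalSpace X]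
    [TopologicalSpace K] {j : X → K} (hj : IsDenseEmbedding j) (E : Set K) :
    IsDenseEmbedding (toUnion j E) := by
  have he : IsEmbedding (toUnion j E) :=
    hj.isEmbedding.codRestrict (range j ∪ E) fun x => Or.inl (mem_range_self x)
  refine ⟨⟨he.isInducing, fun y => ?_⟩, he.injective⟩
  rw [closure_subtype, ← range_comp]
  exact hj.dense y

/-- A continuous function on `X ∪ E` is bounded as soon as `E` contains `φ[ζX \ X]`. -/
theorem IsAdmissible.exists_bound {X : Type u} {K : Type v} [TopologicalSpace X]
    [TopologicalSpace K] {j : X → K} {φ : StoneCech X → K} {E : Set K} (h : IsAdmissible j φ E)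
    (g : C((range j ∪ E : Set K), ℝ)) : ∃ M : ℝ, ∀ y, |g y| ≤ M := by
  have hd := isDenseEmbedding_toUnion h.isCompactification.isDenseEmbedding E
  let f : C(X, ℝ) := g.comp ⟨toUnion j E, hd.continuous⟩
  by_cases hf : ∃ M : ℝ, ∀ x, |f x| ≤ M
  · obtain ⟨M, hM⟩ := hf
    exact ⟨M, fun y => hd.dense.induction_on y
      (isClosed_le g.continuous.abs continuous_const) hM⟩
  exfalso
  obtain ⟨p, hp⟩ := exists_extend_eq_infty_of_unbounded hf
  have hpX : p ∉ range (stoneCechUnit : X → StoneCech X) := by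
    rintro ⟨x, rfl⟩
    rw [stoneCechExtendOnePoint_unit] at hp
    exact OnePoint.coe_ne_infty _ hp
  have hpE : φ p ∈ E :=
    h.image_zeta_subset ⟨p, ⟨Or.inr (subset_closure fun hpυ => hpυ f hp), hpX⟩, rfl⟩
  let q : (range j ∪ E : Set K) := ⟨φ p, Or.inr hpE⟩
  -- The finite value at `q` bounds `g` on a neighbourhood of `q`, whose pullback along `φ` is a
  -- neighbourhood of `p`.
  have hO : IsOpen {y | |g y| < |g q| + 1} := isOpen_lt g.continuous.abs continuous_const
  obtain ⟨W, hW, hWO⟩ := isOpen_induced_iff.1 hO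
  have hmem (y : (range j ∪ E : Set K)) : (y : K) ∈ W ↔ |g y| < |g q| + 1 :=
    Set.ext_iff.1 hWO y
  obtain ⟨x, hxW, hx⟩ := exists_lt_abs_of_extend_eq_infty hp
    (hW.preimage h.continuous_extension) ((hmem q).2 (lt_add_one _)) (|g q| + 1)
  rw [mem_preimage, h.extension_apply] at hxW
  exact lt_asymm hx ((hmem (toUnion j E x)).1 hxW)

theorem IsAdmissible.hasCompactRemainder {X : Type u} {K : Type v} [TopologicalSpace X]
    [TopologicalSpace K] {j : X → K} {φ : StoneCech X → K} {E : Set K}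
    (h : IsAdmissible j φ E) : HasCompactRemainder (toUnion j E) := by
  have : (range (toUnion j E))ᶜ = (Subtype.val ⁻¹' E : Set (range j ∪ E : Set K)) := by
    ext ⟨y, hy⟩
    have hr : (⟨y, hy⟩ : (range j ∪ E : Set K)) ∈ range (toUnion j E) ↔ y ∈ range j := by
      exact exists_congr fun x => Subtype.ext_iff
    rw [mem_compl_iff, hr]
    exact ⟨hy.resolve_left, fun hE => h.subset_remainder hE⟩
  rw [HasCompactRemainder, this]
  exact IsInducing.subtypeVal.isCompact_preimage' h.isCompact
    (by rw [Subtype.range_coe]; exact subset_union_right)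

theorem IsAdmissible.isPseudocompactification {X : Type u} {K : Type v} [TopologicalSpace X]
    [TopologicalSpace K] {j : X → K} {φ : StoneCech X → K} {E : Set K}
    (h : IsAdmissible j φ E) : IsPseudocompactification (toUnion j E) := by
  have := h.isCompactification.compactSpace
  have := h.isCompactification.t2Space
  exact ⟨isDenseEmbedding_toUnion h.isCompactification.isDenseEmbedding E, inferInstance,
    h.exists_bound⟩

/-- The extension by zero along an open embedding of a function that vanishes near the complement
of the range is continuous. -/
theorem Topology.IsOpenEmbedding.continuous_extend_zero {X : Type u} {Y : Type w}
    [TopologicalSpace X] [TopologicalSpace Y] {i : X → Y} (hi : IsOpenEmbedding i) {f : X → ℝ}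
    (hf : Continuous f) (hzero : ∀ y ∉ range i, ∀ᶠ z in 𝓝 y, ∀ x, i x = z → f x = 0) :
    Continuous (Function.extend i f 0) := by
  rw [continuous_iff_continuousAt]
  intro y
  by_cases hy : y ∈ range i
  · obtain ⟨x, rfl⟩ := hy
    rw [← hi.continuousAt_iff, Function.extend_comp hi.injective]
    exact hf.continuousAt
  · refine (continuousAt_const (y := (0 : ℝ))).congr ?_
    filter_upwards [hzero y hy] with z hz
    by_cases hzi : ∃ x, i x = z
    · obtain ⟨x, rfl⟩ := hzi
      rw [hi.injective.extend_apply, hz x rfl]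
    · rw [Function.extend_apply' _ _ _ hzi, Pi.zero_apply]

/-- If `Y` is a pseudocompactification of `X` with compact remainder, then the extension
`βX → βY` maps the points outside `υX` into the remainder. -/
theorem IsPseudocompactification.extend_mem_remainder {X : Type u} {Y : Type w}
    [TopologicalSpace X] [TopologicalSpace Y] {i : X → Y} (hi : IsPseudocompactification i)
    (hr : HasCompactRemainder i) {φ : StoneCech X → StoneCech Y} (hφ : Continuous φ)
    (hφi : ∀ x, φ (stoneCechUnit x) = stoneCechUnit (i x)) {p : StoneCech X}
    (hp : p ∉ hewittRealcompactification X) : φ p ∈ stoneCechUnit '' (range i)ᶜ := by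
  have := hi.isPseudocompactSpace.1
  have hE : IsClosed (stoneCechUnit '' (range i)ᶜ) :=
    (IsCompact.image hr continuous_stoneCechUnit).isClosed
  obtain ⟨f, hf⟩ : ∃ f : C(X, ℝ), stoneCechExtendOnePoint f p = OnePoint.infty := by
    simpa [hewittRealcompactification] using hp
  by_contra hpE
  obtain ⟨g, hg0, hg1, -⟩ := exists_continuous_zero_one_of_isClosed hE
    (isClosed_singleton (x := φ p)) (disjoint_singleton_right.2 hpE)
  -- Subtracting `1 / 4` makes `b` vanish on a neighbourhood of the remainder, not just on it: `f`
  -- may blow up there. Still `b (φ p) ≥ 3 / 4`.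
  let b : StoneCech Y → ℝ := fun q => max 0 (g q - 1 / 4)
  have hb : Continuous b := continuous_const.max (g.continuous.sub continuous_const)
  have hopen : IsOpenEmbedding i :=
    ⟨hi.isDenseEmbedding.isEmbedding, isClosed_compl_iff.1 hr.isClosed⟩
  have hcont : Continuous (Function.extend i (fun x => b (stoneCechUnit (i x)) * f x) 0) := by
    refine hopen.continuous_extend_zero ((hb.comp (continuous_stoneCechUnit.comp
      hopen.continuous)).mul f.continuous) fun y hy => ?_
    have hgy : g (stoneCechUnit y) < 1 / 4 := by
      rw [hg0 (mem_image_of_mem _ hy)]; norm_num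
    filter_upwards [(g.continuous.comp continuous_stoneCechUnit).continuousAt.eventually_lt
      continuousAt_const hgy] with z hz x hx
    subst hx
    have hz' : g (stoneCechUnit (i x)) < 1 / 4 := hz
    have : b (stoneCechUnit (i x)) = 0 := max_eq_left (by linarith)
    rw [this, zero_mul]
  obtain ⟨M, hM⟩ := hi.isPseudocompactSpace.2 ⟨_, hcont⟩
  have hbp : 1 / 2 < b (φ p) := by
    refine lt_max_of_lt_right ?_
    rw [hg1 (mem_singleton _)]; norm_num
  -- Since `b > 1 / 2` near `p`, a value of `|f|` above `2 * M` pushes the product above its bound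
  -- `M`.
  obtain ⟨x, hxb, hxf⟩ := exists_lt_abs_of_extend_eq_infty hf
    (isOpen_lt continuous_const (hb.comp hφ)) hbp (2 * M)
  have hxb' : 1 / 2 < b (stoneCechUnit (i x)) := by rw [← hφi]; exact hxb
  have hle := hM (i x)
  rw [ContinuousMap.coe_mk, hopen.injective.extend_apply, abs_mul,
    abs_of_pos (by linarith)] at hle
  nlinarith [abs_nonneg (f x)]

/-- A pseudocompactification with compact remainder gives admissible data in `βY`. -/
theorem IsPseudocompactification.isAdmissible {X : Type u} {Y : Type w} [TopologicalSpace X]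
    [TopologicalSpace Y] {i : X → Y} (hi : IsPseudocompactification i)
    (hr : HasCompactRemainder i) :
    IsAdmissible (stoneCechUnit ∘ i)
      (stoneCechExtend (continuous_stoneCechUnit.comp hi.isDenseEmbedding.continuous))
      (stoneCechUnit '' (range i)ᶜ) := by
  have := hi.isPseudocompactSpace.1
  have hu : IsDenseEmbedding (stoneCechUnit : Y → StoneCech Y) := isDenseEmbedding_stoneCechUnit
  have hcompact := IsCompact.image hr (continuous_stoneCechUnit (α := Y))
  have hc := continuous_stoneCechExtend
    (continuous_stoneCechUnit.comp hi.isDenseEmbedding.continuous)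
  have hext := congrFun (stoneCechExtend_extends
    (continuous_stoneCechUnit.comp hi.isDenseEmbedding.continuous))
  refine ⟨⟨?_, inferInstance, inferInstance⟩, hc, hext, hcompact, ?_, ?_⟩
  · have he := hu.isEmbedding.comp hi.isDenseEmbedding.isEmbedding
    exact ⟨⟨he.isInducing, hu.dense.comp hi.isDenseEmbedding.dense hu.continuous⟩, he.injective⟩
  · rintro _ ⟨y, hy, rfl⟩ ⟨x, hx⟩
    exact hy ⟨x, hu.injective hx⟩
  · rintro _ ⟨p, ⟨hp, hpX⟩, rfl⟩
    -- The preimage of the compact remainder is closed, so containing `βX \ υX` it contains the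
    -- closure.
    exact closure_minimal (fun q hq => hi.extend_mem_remainder hr hc hext hq)
      (hcompact.isClosed.preimage hc) (hp.resolve_left hpX)

theorem theorem4p4 {X : Type u} [TopologicalSpace X] (hX : IsLocallyPseudocompactSpace X) :
    (∀ (K : Type v) [TopologicalSpace K] (j : X → K) (φ : StoneCech X → K) (E : Set K),
      IsAdmissible j φ E →
        IsPseudocompactification (toUnion j E) ∧ HasCompactRemainder (toUnion j E)) ∧
    (∀ (Y : Type w) [TopologicalSpace Y] (i : X → Y),
      IsPseudocompactification i → HasCompactRemainder i →
        ∃ (K : Type w) (_ : TopologicalSpace K) (j : X → K) (φ : StoneCech X → K) (E : Set K),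
          IsAdmissible j φ E ∧
            ∃ h : Y ≃ₜ (range j ∪ E : Set K), ∀ x, h (i x) = toUnion j E x) := by
  refine ⟨fun K _ j φ E h => ⟨h.isPseudocompactification, h.hasCompactRemainder⟩,
    fun Y _ i hi hr => ⟨StoneCech Y, inferInstance, _, _, _, hi.isAdmissible hr, ?_⟩⟩
  have := hi.isPseudocompactSpace.1
  have hu : IsDenseEmbedding (stoneCechUnit : Y → StoneCech Y) := isDenseEmbedding_stoneCechUnit
  -- Inside `βY`, the set `X ∪ E` is exactly the copy of `Y`.
  have hset : range (stoneCechUnit : Y → StoneCech Y) =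
      range (stoneCechUnit ∘ i) ∪ stoneCechUnit '' (range i)ᶜ := by
    rw [range_comp, ← image_union, union_compl_self, image_univ]
  exact ⟨hu.isEmbedding.toHomeomorph.trans (Homeomorph.setCongr hset), fun x => rfl⟩
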